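/- Let $\mathbb K$ be a field of characteristic zero and let $\mathcal A=\{V(l_1),\dots,V(l_s)\}$ be an arrangement of $s$ distinct lines in $\mathbb P^2_{\mathbb K}$, where $l_1,\dots,l_s\in S=\mathbb K[x,y,z]$ are nonzero linear forms. Assume that $\mathcal A$ has rank 3, i.e. three of the forms $l_i$ are linearly independent. Let $F=l_1\cdots l_s$, and let $$r=r(\mathcal A)=\min\{d\ge 0 : \text{there are } P_1,P_2,P_3\in S, \text{ not all zero and each zero or homogeneous of degree } d, \text{ with } P_1F_x+P_2F_y+P_3F_z=0\}$$ be the minimal degree of a Jacobian relation. Let $m=m(\mathcal A)$ be the largest number of lines of $\mathcal A$ passing through a common point of two distinct lines of $\mathcal A$. For $H\in\mathcal A$ let $\mathcal A^H=\{H\cap L : L\in\mathcal A\setminus\{H\}\}$, so that $|H|:=|\mathcal A^H|$ is the number of intersection points of $\mathcal A$ on $H$. Then $$r=s-m\quad\text{or}\quad r\ge \min\{|\mathcal A^H| : H\in\mathcal A\}-1,$$ and consequently $$\min\{|H| : H\in\mathcal A\}-1\ \le\ r\ \le\ s-m .$$ -/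

import Mathlib

open MvPolynomial

/-- An arrangement of `s` distinct lines `V(l₁), …, V(l_s)` in the projective plane over `K`,
given by nonzero linear forms on `K³`. The line `V(l)` is regarded as the plane `ker l` through
the origin of `K³`. -/
structure LineArrangement (K : Type*) [Field K] (s : ℕ) where
  form : Fin s → Module.Dual K (Fin 3 → K)
  form_ne_zero : ∀ i, form i ≠ 0
  ker_injective : Function.Injective fun i => LinearMap.ker (form i)

namespace LineArrangement

variable {K : Type*} [Field K] {s : ℕ}

/-- The line `V(l_i)`, as a linear plane in `K³`. -/
def line (A : LineArrangement K s) (i : Fin s) : Submodule K (Fin 3 → K) :=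
  LinearMap.ker (A.form i)

/-- The rank of the arrangement: the dimension of the span of its linear forms. -/
noncomputable def rank (A : LineArrangement K s) : ℕ :=
  Module.finrank K (Submodule.span K (Set.range A.form))

/-- The restriction of the arrangement to its line `H = V(l_i)`: the set of all intersections
`H ∩ L` with `L` a line of the arrangement different from `H`. -/
def restriction (A : LineArrangement K s) (i : Fin s) : Set (Submodule K (Fin 3 → K)) :=
  {P | ∃ j, j ≠ i ∧ P = A.line i ⊓ A.line j}

/-- The singular locus: the intersection points of two distinct lines of the arrangement
(a point of the projective plane is a one-dimensional subspace of `K³`). -/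
def sing (A : LineArrangement K s) : Set (Submodule K (Fin 3 → K)) :=
  {P | ∃ i j, i ≠ j ∧ P = A.line i ⊓ A.line j}

/-- The multiplicity of a point: the number of lines of the arrangement passing through it. -/
noncomputable def multiplicity (A : LineArrangement K s) (P : Submodule K (Fin 3 → K)) : ℕ :=
  {i : Fin s | P ≤ A.line i}.ncard

/-- The maximal multiplicity of a singular point. The set of values is bounded by `s`, and it is
nonempty as soon as there are two lines. -/
noncomputable def maxMultiplicity (A : LineArrangement K s) : ℕ :=
  sSup (A.multiplicity '' A.sing)

/-- The minimum of the cardinality of the restriction to `H`, over the lines `H` of the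
arrangement. The set of values is nonempty as soon as there is a line. -/
noncomputable def minRestriction (A : LineArrangement K s) : ℕ :=
  sInf (Set.range fun i => (A.restriction i).ncard)

/-- A linear form on `K³`, as a polynomial in the coordinates. -/
noncomputable def formPoly (l : Module.Dual K (Fin 3 → K)) : MvPolynomial (Fin 3) K :=
  ∑ k, C (l (Pi.single k 1)) * X k

/-- The defining polynomial `F = l₁ ⋯ l_s`. -/
noncomputable def definingPoly (A : LineArrangement K s) : MvPolynomial (Fin 3) K :=
  ∏ i, formPoly (A.form i)

end LineArrangement

/-- The module of syzygies of the partial derivatives of `F`: the triples `(P₁, P₂, P₃)` with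
`P₁ F_x + P₂ F_y + P₃ F_z = 0`. -/
noncomputable def jacobianSyzygies {K : Type*} [Field K] (F : MvPolynomial (Fin 3) K) :
    Submodule (MvPolynomial (Fin 3) K) (Fin 3 → MvPolynomial (Fin 3) K) where
  carrier := {P | ∑ k, P k * pderiv k F = 0}
  add_mem' := by
    intro P Q hP hQ
    simp only [Set.mem_setOf_eq, Pi.add_apply, add_mul, Finset.sum_add_distrib] at *
    rw [hP, hQ, add_zero]
  zero_mem' := by simp
  smul_mem' := by
    intro c P hP
    simp only [Set.mem_setOf_eq, Pi.smul_apply, smul_eq_mul, mul_assoc] at *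
    rw [← Finset.mul_sum, hP, mul_zero]

/-- The degrees `d` in which there is a nonzero homogeneous Jacobian syzygy of `F`. -/
def jacobianSyzygyDegrees {K : Type*} [Field K] (F : MvPolynomial (Fin 3) K) : Set ℕ :=
  {d | ∃ P ∈ jacobianSyzygies F, P ≠ 0 ∧ ∀ k, (P k).IsHomogeneous d}

/-- `r(A) = mdr(A)`, the minimal degree of a nonzero Jacobian relation of the defining
polynomial. -/
noncomputable def LineArrangement.mdr {K : Type*} [Field K] {s : ℕ}
    (A : LineArrangement K s) : ℕ :=
  sInf (jacobianSyzygyDegrees A.definingPoly)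

/-! Regard a Jacobian syzygy `P` of degree d as a vector field killing F. By the product rule it is
tangent to every line (`eval_syzygy_mem_line`), so at a point of two lines it is a multiple of the
position vector, and its 2 × 2 minors against the Euler field E, of degree d + 1, vanish there. If d
+ 1 is less than the number of points on each line, the minors vanish on each line, hence
identically because d + 1 < s; Euler's formula then forces `P = 0`. So the lower bound on r holds
without exception, and the dichotomy follows from it.

For the upper bound, let p lie on m lines, let B be the product of the other forms and ∂ the
derivative in direction p. As ∂ kills the forms through p, the field s B p − (∂B) E is a nonzero
syzygy of degree s − m. -/

namespace MvPolynomial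

/-! ### Polynomials on affine lines -/

variable {K σ : Type*} [Field K]

/-- The restriction of a polynomial to the affine line through `w` with direction `v`. -/
noncomputable def restrictLine (w v : σ → K) : MvPolynomial σ K →ₐ[K] Polynomial K :=
  aeval fun k => Polynomial.C (w k) + Polynomial.C (v k) * Polynomial.X

theorem eval_restrictLine (w v : σ → K) (Q : MvPolynomial σ K) (t : K) :
    (restrictLine w v Q).eval t = eval (w + t • v) Q := by
  have h : (Polynomial.evalRingHom t).comp (restrictLine w v : MvPolynomial σ K →+* Polynomial K)
      = eval (w + t • v) := by
    ext k
    · simp [restrictLine]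
    · simp [restrictLine]
      ring
  exact RingHom.congr_fun h Q

theorem natDegree_restrictLine_le {w v : σ → K} {Q : MvPolynomial σ K} {n : ℕ}
    (hQ : Q.totalDegree ≤ n) : (restrictLine w v Q).natDegree ≤ n := by
  have h := aeval_natDegree_le (n := 1) Q hQ
    (fun k => Polynomial.C (w k) + Polynomial.C (v k) * Polynomial.X)
    (fun k => by compute_degree)
  simpa [restrictLine] using h

/-- A polynomial of degree at most `n` that vanishes at more than `n` points of an affine line
vanishes on this line. -/
theorem eval_eq_zero_of_card_lt {w v : σ → K} {Q : MvPolynomial σ K} {n : ℕ}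
    (hQ : Q.totalDegree ≤ n) (T : Finset K) (hT : n < T.card)
    (h : ∀ t ∈ T, eval (w + t • v) Q = 0) : eval w Q = 0 := by
  have h0 : restrictLine w v Q = 0 :=
    Polynomial.eq_zero_of_natDegree_lt_card_of_eval_eq_zero' _ T
      (fun t ht => by rw [eval_restrictLine, h t ht])
      ((natDegree_restrictLine_le hQ).trans_lt hT)
  simpa [h0] using (eval_restrictLine w v Q 0).symm

end MvPolynomial

/-- A subspace over an infinite field that lies in none of finitely many subspaces has a vector
outside all of them. -/
theorem Submodule.exists_mem_forall_notMem {K V : Type*} [Field K] [Infinite K] [AddCommGroup V]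
    [Module K V] (W : Submodule K V) (T : Finset (Submodule K V)) (hT : ∀ U ∈ T, ¬ W ≤ U) :
    ∃ v ∈ W, ∀ U ∈ T, v ∉ U := by
  classical
  by_contra! hc
  have htop : (⊤ : Submodule K W) ∉ T.image fun U => U.comap W.subtype := by
    intro hm
    obtain ⟨U, hU, h⟩ := Finset.mem_image.1 hm
    exact hT U hU fun x hx => by
      have : (⟨x, hx⟩ : W) ∈ U.comap W.subtype := h ▸ Submodule.mem_top
      simpa using this
  refine Subspace.biUnion_ne_univ_of_top_notMem htop (Set.eq_univ_of_forall fun x => ?_)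
  obtain ⟨U, hU, hx⟩ := hc x x.2
  exact Set.mem_biUnion (Finset.mem_coe.2 (Finset.mem_image_of_mem _ hU)) hx

namespace LineArrangement

/-! ### Linear forms and minors against the Euler field -/

section Forms

variable {K : Type*} [Field K]

theorem dual_apply_eq_sum (l : Module.Dual K (Fin 3 → K)) (w : Fin 3 → K) :
    l w = ∑ k, l (Pi.single k 1) * w k := by
  conv_lhs => rw [pi_eq_sum_univ' w]
  simp [map_sum, mul_comm]

theorem eval_formPoly (l : Module.Dual K (Fin 3 → K)) (w : Fin 3 → K) :
    eval w (formPoly l) = l w := by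
  simp [formPoly, dual_apply_eq_sum l w]

theorem pderiv_formPoly (l : Module.Dual K (Fin 3 → K)) (k : Fin 3) :
    pderiv k (formPoly l) = C (l (Pi.single k 1)) := by
  simp [formPoly, pderiv_X, Pi.single_apply]

theorem isHomogeneous_formPoly (l : Module.Dual K (Fin 3 → K)) : (formPoly l).IsHomogeneous 1 :=
  IsHomogeneous.sum _ _ _ fun k _ => by
    simpa using (isHomogeneous_C (Fin 3) (l (Pi.single k 1))).mul (isHomogeneous_X K k)

theorem formPoly_ne_zero {l : Module.Dual K (Fin 3 → K)} (hl : l ≠ 0) : formPoly l ≠ 0 := by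
  intro h
  refine hl (LinearMap.ext fun w => ?_)
  rw [← eval_formPoly, h, map_zero, LinearMap.zero_apply]

theorem isHomogeneous_prod_formPoly {ι : Type*} (T : Finset ι)
    (l : ι → Module.Dual K (Fin 3 → K)) : (∏ i ∈ T, formPoly (l i)).IsHomogeneous T.card := by
  simpa using IsHomogeneous.prod T (fun i => formPoly (l i)) (fun _ => 1)
    fun i _ => isHomogeneous_formPoly (l i)

/-- The `2 × 2` minors of the matrix with rows `P` and `(x, y, z)`. -/
noncomputable def eulerMinor (P : Fin 3 → MvPolynomial (Fin 3) K) (a b : Fin 3) :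
    MvPolynomial (Fin 3) K :=
  P a * X b - P b * X a

theorem totalDegree_eulerMinor_le {P : Fin 3 → MvPolynomial (Fin 3) K} {d : ℕ}
    (hP : ∀ k, (P k).IsHomogeneous d) (a b : Fin 3) :
    (eulerMinor P a b).totalDegree ≤ d + 1 :=
  (((hP a).mul (isHomogeneous_X K b)).sub ((hP b).mul (isHomogeneous_X K a))).totalDegree_le

theorem eval_eulerMinor (P : Fin 3 → MvPolynomial (Fin 3) K) (a b : Fin 3) (w : Fin 3 → K) :
    eval w (eulerMinor P a b) = eval w (P a) * w b - eval w (P b) * w a := by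
  simp [eulerMinor]

/-- A Jacobian syzygy that is parallel to the Euler field vanishes. -/
theorem eq_zero_of_eulerMinor_eq_zero [CharZero K] {F : MvPolynomial (Fin 3) K} {n : ℕ}
    (hF : F.IsHomogeneous n) (hn : n ≠ 0) (hF0 : F ≠ 0) {P : Fin 3 → MvPolynomial (Fin 3) K}
    (hP : P ∈ jacobianSyzygies F) (h : ∀ a b, eulerMinor P a b = 0) : P = 0 := by
  funext a
  have hP' : ∑ k, P k * pderiv k F = 0 := hP
  -- Vanishing minors exchange `P a * X k` for `P k * X a`; by Euler's formula the left side is `P a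
  -- * (n * F)`.
  have h1 : P a * ∑ k, X k * pderiv k F = 0 := by
    calc P a * ∑ k, X k * pderiv k F = X a * ∑ k, P k * pderiv k F := by
          rw [Finset.mul_sum, Finset.mul_sum]
          refine Finset.sum_congr rfl fun k _ => ?_
          have hk : P a * X k - P k * X a = 0 := h a k
          linear_combination pderiv k F * hk
      _ = 0 := by rw [hP', mul_zero]
  rw [hF.sum_X_mul_pderiv, nsmul_eq_mul] at h1
  have hn' : (n : MvPolynomial (Fin 3) K) ≠ 0 := Nat.cast_ne_zero.2 hn
  simpa [hF0, hn'] using h1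

end Forms

/-! ### Incidence, tangency and vanishing on the lines -/

variable {K : Type*} [Field K] {s : ℕ} (A : LineArrangement K s)

theorem mem_line {i : Fin s} {w : Fin 3 → K} : w ∈ A.line i ↔ A.form i w = 0 := LinearMap.mem_ker

theorem finrank_line (i : Fin s) : Module.finrank K (A.line i) = 2 := by
  have := Module.Dual.finrank_ker_add_one_of_ne_zero (A.form_ne_zero i)
  rw [Module.finrank_fin_fun] at this
  change Module.finrank K (LinearMap.ker (A.form i)) = 2
  omega

theorem not_line_le_line {i j : Fin s} (h : i ≠ j) : ¬ A.line i ≤ A.line j := fun hle =>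
  h (A.ker_injective
    (Submodule.eq_of_le_of_finrank_eq hle ((A.finrank_line i).trans (A.finrank_line j).symm)))

theorem finrank_inf_line {i j : Fin s} (h : i ≠ j) :
    Module.finrank K ↥(A.line i ⊓ A.line j) = 1 := by
  have h1 := Submodule.finrank_sup_add_finrank_inf_eq (A.line i) (A.line j)
  have h2 : A.line i < A.line i ⊔ A.line j :=
    left_lt_sup.2 (A.not_line_le_line h.symm)
  have h3 := Submodule.finrank_lt_finrank_of_lt h2
  have h4 := Submodule.finrank_le (A.line i ⊔ A.line j)
  rw [Module.finrank_fin_fun] at h4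
  rw [finrank_line] at h1 h3
  rw [finrank_line] at h1
  omega

theorem inf_line_eq_span {i j : Fin s} (h : i ≠ j) {w : Fin 3 → K} (hw : w ≠ 0)
    (hi : w ∈ A.line i) (hj : w ∈ A.line j) : A.line i ⊓ A.line j = K ∙ w :=
  (Submodule.eq_of_le_of_finrank_eq
    ((Submodule.span_singleton_le_iff_mem _ _).2 (Submodule.mem_inf.2 ⟨hi, hj⟩))
    (by rw [finrank_span_singleton hw, A.finrank_inf_line h])).symm

theorem definingPoly_isHomogeneous : A.definingPoly.IsHomogeneous s := by
  simpa [definingPoly] using isHomogeneous_prod_formPoly Finset.univ A.form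

theorem definingPoly_ne_zero : A.definingPoly ≠ 0 :=
  Finset.prod_ne_zero_iff.2 fun i _ => formPoly_ne_zero (A.form_ne_zero i)

/-- The vector field of a Jacobian syzygy is tangent to every line of the arrangement. -/
theorem eval_syzygy_mem_line [Infinite K] {P : Fin 3 → MvPolynomial (Fin 3) K}
    (hP : P ∈ jacobianSyzygies A.definingPoly) {i : Fin s} {w : Fin 3 → K} (hw : w ∈ A.line i) :
    (fun k => eval w (P k)) ∈ A.line i := by
  classical
  set G : MvPolynomial (Fin 3) K := ∏ j ∈ Finset.univ.erase i, formPoly (A.form j) with hG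
  set D : MvPolynomial (Fin 3) K := ∑ k, P k * C (A.form i (Pi.single k 1)) with hD
  have hF : A.definingPoly = formPoly (A.form i) * G :=
    (Finset.mul_prod_erase _ _ (Finset.mem_univ i)).symm
  have hP' : D * G + formPoly (A.form i) * ∑ k, P k * pderiv k G = 0 := by
    have h : ∑ k, P k * pderiv k A.definingPoly = 0 := hP
    rw [hF] at h
    rw [← h, hD, Finset.sum_mul, Finset.mul_sum, ← Finset.sum_add_distrib]
    refine Finset.sum_congr rfl fun k _ => ?_
    rw [pderiv_mul, pderiv_formPoly]
    ring
  -- Along `w + t • v`, inside line `i`, every other form is nonconstant, so `G` does not vanish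
  -- identically there, even when `w` itself lies on other lines.
  obtain ⟨v, hvi, hv⟩ := (A.line i).exists_mem_forall_notMem
    ((Finset.univ.erase i).image A.line) (by
      intro U hU
      obtain ⟨j, hj, rfl⟩ := Finset.mem_image.1 hU
      exact A.not_line_le_line (Finset.ne_of_mem_erase hj).symm)
  have hzero : restrictLine w v D * restrictLine w v G = 0 := by
    refine Polynomial.funext fun t => ?_
    have h := congrArg (eval (w + t • v)) hP'
    have ht : A.form i (w + t • v) = 0 := by
      rw [map_add, map_smul, A.mem_line.1 hw, A.mem_line.1 hvi, smul_zero, add_zero]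
    rw [map_add, map_mul, map_mul, eval_formPoly, ht, zero_mul, add_zero, map_zero] at h
    rw [Polynomial.eval_mul, eval_restrictLine, eval_restrictLine, h, Polynomial.eval_zero]
  have hG0 : restrictLine w v G ≠ 0 := by
    rw [hG, map_prod, Finset.prod_ne_zero_iff]
    intro j hj h0
    have ht (t : K) : A.form j (w + t • v) = 0 := by
      rw [← eval_formPoly, ← eval_restrictLine, h0, Polynomial.eval_zero]
    have h1 := ht 1
    have h2 := ht 0
    simp only [map_add, one_smul, zero_smul, add_zero] at h1 h2
    rw [h2, zero_add] at h1
    exact hv _ (Finset.mem_image_of_mem _ hj) (A.mem_line.2 h1)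
  have hD0 := (mul_eq_zero.1 hzero).resolve_right hG0
  have h := eval_restrictLine w v D 0
  rw [hD0, Polynomial.eval_zero, zero_smul, add_zero, hD, map_sum] at h
  rw [mem_line, dual_apply_eq_sum, h]
  exact Finset.sum_congr rfl fun k _ => by rw [map_mul, eval_C, mul_comm]

/-- Tangency to both lines puts `P(w)` in their intersection, which `w` spans when `w ≠ 0`. -/
theorem eval_eulerMinor_eq_zero_of_mem_inf [Infinite K] {P : Fin 3 → MvPolynomial (Fin 3) K}
    (hP : P ∈ jacobianSyzygies A.definingPoly) {i j : Fin s} (hij : i ≠ j) {w : Fin 3 → K}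
    (hi : w ∈ A.line i) (hj : w ∈ A.line j) (a b : Fin 3) : eval w (eulerMinor P a b) = 0 := by
  rw [eval_eulerMinor]
  by_cases hw : w = 0
  · simp [hw]
  have hmem : (fun k => eval w (P k)) ∈ A.line i ⊓ A.line j :=
    ⟨A.eval_syzygy_mem_line hP hi, A.eval_syzygy_mem_line hP hj⟩
  rw [A.inf_line_eq_span hij hw hi hj] at hmem
  obtain ⟨c, hc⟩ := Submodule.mem_span_singleton.1 hmem
  have h (k : Fin 3) : eval w (P k) = c * w k := (congrFun hc k).symm
  rw [h, h]
  ring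

/-- A polynomial of degree less than the number of points of the arrangement on the line `H`
that vanishes at these points vanishes on `H`. -/
theorem eval_eq_zero_of_mem_line [Infinite K] {Q : MvPolynomial (Fin 3) K} {n : ℕ}
    (hQ : Q.totalDegree ≤ n) {i : Fin s} (hn : n < (A.restriction i).ncard)
    (h : ∀ j ≠ i, ∀ u ∈ A.line i ⊓ A.line j, eval u Q = 0) {w : Fin 3 → K}
    (hw : w ∈ A.line i) : eval w Q = 0 := by
  classical
  -- Avoiding `K ∙ w` keeps `w + t • v` away from the origin when `w ≠ 0`; avoiding the other lines
  -- makes each of them meet this affine line at exactly one parameter. Distinct points on `H` then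
  -- give distinct parameters.
  obtain ⟨v, hvi, hv⟩ := (A.line i).exists_mem_forall_notMem
    (insert (K ∙ w) ((Finset.univ.erase i).image A.line)) (by
      intro U hU
      rcases Finset.mem_insert.1 hU with rfl | hU
      · intro hle
        have h1 := Submodule.finrank_mono hle
        have h2 := finrank_span_le_card (R := K) ({w} : Set (Fin 3 → K))
        rw [finrank_line] at h1
        simp at h2
        omega
      · obtain ⟨j, hj, rfl⟩ := Finset.mem_image.1 hU
        exact A.not_line_le_line (Finset.ne_of_mem_erase hj).symm)
  by_cases hw0 : w = 0
  · obtain ⟨_, j, hj, -⟩ := Set.nonempty_of_ncard_ne_zero (Nat.ne_zero_of_lt hn)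
    exact h j hj w (hw0 ▸ Submodule.zero_mem _)
  have hvj (j : Fin s) (hj : j ≠ i) : A.form j v ≠ 0 := fun h0 =>
    hv _ (Finset.mem_insert_of_mem (Finset.mem_image_of_mem _
      (Finset.mem_erase.2 ⟨hj, Finset.mem_univ j⟩))) (A.mem_line.2 h0)
  have hne (t : K) : w + t • v ≠ 0 := by
    intro h0
    have ht : t ≠ 0 := by
      rintro rfl
      simp [hw0] at h0
    refine hv _ (Finset.mem_insert_self _ _) (Submodule.mem_span_singleton.2 ⟨-t⁻¹, ?_⟩)
    rw [eq_neg_of_add_eq_zero_left h0, neg_smul, smul_neg, neg_neg, smul_smul,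
      inv_mul_cancel₀ ht, one_smul]
  have hmi (t : K) : w + t • v ∈ A.line i := add_mem hw (Submodule.smul_mem _ _ hvi)
  have hmj (j : Fin s) (hj : j ≠ i) : w + (-A.form j w / A.form j v) • v ∈ A.line j := by
    rw [mem_line, map_add, map_smul, smul_eq_mul, div_mul_cancel₀ _ (hvj j hj), add_neg_cancel]
  set T : Finset K := (Finset.univ.erase i).image fun j => -A.form j w / A.form j v with hT
  refine eval_eq_zero_of_card_lt (v := v) hQ T ?_ ?_
  · have hsub : A.restriction i ⊆ (fun t : K => K ∙ (w + t • v)) '' (T : Set K) := by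
      rintro _ ⟨j, hj, rfl⟩
      refine ⟨-A.form j w / A.form j v, ?_, ?_⟩
      · exact Finset.mem_coe.2 (Finset.mem_image_of_mem _
          (Finset.mem_erase.2 ⟨hj, Finset.mem_univ j⟩))
      · exact (A.inf_line_eq_span hj.symm (hne _) (hmi _) (hmj j hj)).symm
    calc n < (A.restriction i).ncard := hn
      _ ≤ _ := Set.ncard_le_ncard hsub (T.finite_toSet.image _)
      _ ≤ (T : Set K).ncard := Set.ncard_image_le T.finite_toSet
      _ = T.card := Set.ncard_coe_finset T
  · intro t ht
    obtain ⟨j, hj, rfl⟩ := Finset.mem_image.1 ht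
    have hj := Finset.ne_of_mem_erase hj
    exact h j hj _ ⟨hmi _, hmj j hj⟩

/-- A polynomial of degree less than the number of lines of the arrangement that vanishes on these
lines is zero. -/
theorem eq_zero_of_forall_mem_line [Infinite K] {Q : MvPolynomial (Fin 3) K} {n : ℕ}
    (hQ : Q.totalDegree ≤ n) (hn : n < s) (h : ∀ i, ∀ u ∈ A.line i, eval u Q = 0) : Q = 0 := by
  classical
  refine MvPolynomial.funext fun w => ?_
  rw [map_zero]
  by_cases hw : ∃ i, w ∈ A.line i
  · obtain ⟨i, hi⟩ := hw
    exact h i w hi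
  replace hw (i : Fin s) : A.form i w ≠ 0 := fun h0 => hw ⟨i, A.mem_line.2 h0⟩
  -- `g (i, j) v ≠ 0` says that the affine line through `w` with direction `v` meets lines `i` and
  -- `j` at different parameters.
  let g (p : Fin s × Fin s) : Module.Dual K (Fin 3 → K) :=
    A.form p.1 w • A.form p.2 - A.form p.2 w • A.form p.1
  obtain ⟨v, -, hv⟩ := (⊤ : Submodule K (Fin 3 → K)).exists_mem_forall_notMem
    (Finset.univ.image A.line ∪ Finset.univ.offDiag.image fun p => LinearMap.ker (g p)) (by
      intro U hU
      rcases Finset.mem_union.1 hU with hU | hU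
      · obtain ⟨j, -, rfl⟩ := Finset.mem_image.1 hU
        exact fun hle => hw j (A.mem_line.1 (hle (Submodule.mem_top (x := w))))
      · obtain ⟨⟨i, j⟩, hp, rfl⟩ := Finset.mem_image.1 hU
        have hij : i ≠ j := (Finset.mem_offDiag.1 hp).2.2
        refine fun hle => A.not_line_le_line hij fun u hu => ?_
        have hgu : g (i, j) u = 0 := hle Submodule.mem_top
        simp only [g, LinearMap.sub_apply, LinearMap.smul_apply, A.mem_line.1 hu, smul_eq_mul,
          mul_zero, sub_zero] at hgu
        exact A.mem_line.2 ((mul_eq_zero.1 hgu).resolve_left (hw i)))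
  have hvj (j : Fin s) : A.form j v ≠ 0 := fun h0 =>
    hv _ (Finset.mem_union_left _ (Finset.mem_image_of_mem _ (Finset.mem_univ j)))
      (A.mem_line.2 h0)
  have hinj : Function.Injective fun j : Fin s => -A.form j w / A.form j v := by
    intro i j hij
    by_contra hne
    have hp : (i, j) ∈ (Finset.univ : Finset (Fin s)).offDiag := by simpa using hne
    refine hv _ (Finset.mem_union_right _ (Finset.mem_image_of_mem _ hp)) ?_
    have hij' := (div_eq_div_iff (hvj i) (hvj j)).1 hij
    rw [LinearMap.mem_ker]
    simp only [g, LinearMap.sub_apply, LinearMap.smul_apply, smul_eq_mul]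
    linear_combination -hij'
  refine eval_eq_zero_of_card_lt (v := v) hQ (Finset.univ.image fun j => -A.form j w / A.form j v)
    (by rw [Finset.card_image_of_injective _ hinj]; simpa using hn) ?_
  intro t ht
  obtain ⟨j, -, rfl⟩ := Finset.mem_image.1 ht
  refine h j _ ?_
  rw [mem_line, map_add, map_smul, smul_eq_mul, div_mul_cancel₀ _ (hvj j), add_neg_cancel]

/-! ### The lower bound -/

theorem ncard_restriction_lt (i : Fin s) : (A.restriction i).ncard < s := by
  classical
  have hsub : A.restriction i ⊆
      (fun j => A.line i ⊓ A.line j) '' ((Finset.univ.erase i : Finset (Fin s)) : Set (Fin s)) := by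
    rintro _ ⟨j, hj, rfl⟩
    exact ⟨j, by simpa using hj, rfl⟩
  have h1 := (Set.ncard_le_ncard hsub (Set.toFinite _)).trans (Set.ncard_image_le (Set.toFinite _))
  rw [Set.ncard_coe_finset, Finset.card_erase_of_mem (Finset.mem_univ i), Finset.card_univ,
    Fintype.card_fin] at h1
  have := i.pos
  omega

theorem minRestriction_le (i : Fin s) : A.minRestriction ≤ (A.restriction i).ncard :=
  Nat.sInf_le ⟨i, rfl⟩

/-- The degree of a nonzero Jacobian syzygy is at least the minimal number of points on a line of
the arrangement, minus one. -/
theorem minRestriction_le_degree_add_one [CharZero K] (hs : 0 < s) {d : ℕ}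
    (hd : d ∈ jacobianSyzygyDegrees A.definingPoly) : A.minRestriction ≤ d + 1 := by
  obtain ⟨P, hP, hP0, hdeg⟩ := hd
  by_contra! hlt
  -- A line carries at most s − 1 points, so smallness relative to one line already gives smallness
  -- relative to s.
  have hds : d + 1 < s :=
    (hlt.trans_le (A.minRestriction_le ⟨0, hs⟩)).trans (A.ncard_restriction_lt _)
  refine hP0 (eq_zero_of_eulerMinor_eq_zero A.definingPoly_isHomogeneous hs.ne'
    A.definingPoly_ne_zero hP fun a b => ?_)
  have hQ := totalDegree_eulerMinor_le hdeg a b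
  refine A.eq_zero_of_forall_mem_line hQ hds fun i u hu => ?_
  exact A.eval_eq_zero_of_mem_line hQ (hlt.trans_le (A.minRestriction_le i))
    (fun j hj x hx => A.eval_eulerMinor_eq_zero_of_mem_inf hP hj.symm hx.1 hx.2 a b) hu

/-! ### The upper bound -/

/-- If the lines indexed by `T` pass through a common point, then there is a nonzero Jacobian syzygy
of degree the number of the remaining lines. -/
theorem card_compl_mem_jacobianSyzygyDegrees [CharZero K] (hs : 0 < s) {p : Fin 3 → K} (hp : p ≠ 0)
    (T : Finset (Fin s)) (hT : ∀ i ∈ T, p ∈ A.line i) :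
    Tᶜ.card ∈ jacobianSyzygyDegrees A.definingPoly := by
  classical
  set n := Tᶜ.card with hn
  set G : MvPolynomial (Fin 3) K := ∏ i ∈ T, formPoly (A.form i) with hG
  set B : MvPolynomial (Fin 3) K := ∏ i ∈ Tᶜ, formPoly (A.form i) with hB
  have hF : A.definingPoly = G * B := (Finset.prod_mul_prod_compl T _).symm
  have hBhom : B.IsHomogeneous n := isHomogeneous_prod_formPoly _ _
  have hB0 : B ≠ 0 := Finset.prod_ne_zero_iff.2 fun i _ => formPoly_ne_zero (A.form_ne_zero i)
  let D : Derivation K (MvPolynomial (Fin 3) K) (MvPolynomial (Fin 3) K) :=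
    (C (p 0) : MvPolynomial (Fin 3) K) • pderiv 0 + (C (p 1) : MvPolynomial (Fin 3) K) • pderiv 1 +
      (C (p 2) : MvPolynomial (Fin 3) K) • pderiv 2
  have hD (Q : MvPolynomial (Fin 3) K) : D Q = ∑ k, C (p k) * pderiv k Q := by
    simp [D, Fin.sum_univ_three]
  have hDG : D G = 0 := by
    refine Finset.prod_induction _ (fun Q => D Q = 0)
      (fun Q R hQ hR => by simp [Derivation.leibniz, hQ, hR]) D.map_one_eq_zero fun i hi => ?_
    rw [hD]
    simp only [pderiv_formPoly, ← C_mul, ← map_sum]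
    rw [← C_0, ← A.mem_line.1 (hT i hi), dual_apply_eq_sum]
    simp only [mul_comm]
  have hDF : D A.definingPoly = G * D B := by
    rw [hF, Derivation.leibniz, hDG, smul_zero, add_zero, smul_eq_mul]
  have hDBhom (k : Fin 3) : (D B * X k).IsHomogeneous n := by
    -- For `n = 0` the degree `n - 1` of `D B` is truncated, but `B` is then constant and `D B = 0`.
    rcases Nat.eq_zero_or_pos n with h0 | h0
    · have hcoe : B = C (B.coeff 0) := by
        refine totalDegree_eq_zero_iff_eq_C.1 ?_
        have := hBhom.totalDegree_le
        omega
      have : D B = 0 := by rw [hcoe, hD]; simp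
      rw [this, zero_mul]
      exact isHomogeneous_zero _ _ _
    · have hDB : (D B).IsHomogeneous (n - 1) := by
        rw [hD]
        exact IsHomogeneous.sum _ _ _ fun k _ => by
          simpa using (isHomogeneous_C (Fin 3) (p k)).mul (hBhom.pderiv (i := k))
      have := hDB.mul (isHomogeneous_X K k)
      rwa [Nat.sub_add_cancel h0] at this
  -- `D` sends F to `G * D B` and E sends it to `s * F = s * G * B`; this combination cancels the
  -- two.
  refine ⟨fun k => C (s * p k) * B - D B * X k, ?_, ?_, fun k => ?_⟩
  · change ∑ k, (C (s * p k) * B - D B * X k) * pderiv k A.definingPoly = 0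
    calc ∑ k, (C (s * p k) * B - D B * X k) * pderiv k A.definingPoly
        = s * B * D A.definingPoly - D B * ∑ k, X k * pderiv k A.definingPoly := by
          rw [hD A.definingPoly, Finset.mul_sum, Finset.mul_sum, ← Finset.sum_sub_distrib]
          refine Finset.sum_congr rfl fun k _ => ?_
          rw [C_mul, map_natCast]
          ring
      _ = 0 := by
          rw [hDF, A.definingPoly_isHomogeneous.sum_X_mul_pderiv, hF, nsmul_eq_mul]
          ring
  · intro h0
    have hk (k : Fin 3) : C (s * p k) * B = D B * X k := sub_eq_zero.1 (congrFun h0 k)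
    obtain ⟨a, ha⟩ := Function.ne_iff.1 hp
    obtain ⟨b, hb⟩ : ∃ b : Fin 3, b ≠ a := exists_ne a
    have h1 : B * (C (s * p a) * X b - C (s * p b) * X a) = 0 := by
      linear_combination X b * hk a - X a * hk b
    have h2 := (mul_eq_zero.1 h1).resolve_left hB0
    -- At the basis vector of index `b ≠ a` the bracket takes the value `s * p a`, which is nonzero.
    have h3 := congrArg (eval (Pi.single b 1)) h2
    simp [hb.symm, hs.ne'] at h3
    exact ha h3
  · refine IsHomogeneous.sub ?_ (hDBhom k)
    simpa using (isHomogeneous_C (Fin 3) ((s : K) * p k)).mul hBhom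

theorem rank_le : A.rank ≤ s := by
  simpa [rank, Set.finrank] using finrank_range_le_card (R := K) A.form

theorem multiplicity_le (P : Submodule K (Fin 3 → K)) : A.multiplicity P ≤ s := by
  simpa [multiplicity] using Set.ncard_le_card {i : Fin s | P ≤ A.line i}

theorem maxMultiplicity_mem (hs : 2 ≤ s) : A.maxMultiplicity ∈ A.multiplicity '' A.sing := by
  refine Nat.sSup_mem ⟨_, Set.mem_image_of_mem _
    ⟨⟨0, by omega⟩, ⟨1, by omega⟩, by simp, rfl⟩⟩ ⟨s, ?_⟩
  rintro _ ⟨P, -, rfl⟩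
  exact A.multiplicity_le P

theorem sub_maxMultiplicity_mem_degrees [CharZero K] (hs : 2 ≤ s) :
    s - A.maxMultiplicity ∈ jacobianSyzygyDegrees A.definingPoly := by
  classical
  obtain ⟨P, ⟨i, j, hij, rfl⟩, hm⟩ := A.maxMultiplicity_mem hs
  have hbot : A.line i ⊓ A.line j ≠ ⊥ := by
    intro h0
    have := A.finrank_inf_line hij
    rw [h0, finrank_bot] at this
    omega
  obtain ⟨p, hp, hp0⟩ := Submodule.exists_mem_ne_zero_of_ne_bot hbot
  have h := A.card_compl_mem_jacobianSyzygyDegrees (by omega) hp0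
    {k | A.line i ⊓ A.line j ≤ A.line k} fun k hk => (Finset.mem_filter.1 hk).2 hp
  rw [Finset.card_compl, Fintype.card_fin] at h
  rw [← hm, multiplicity, Set.ncard_eq_toFinset_card']
  simpa using h

end LineArrangement

theorem corollary2p2 {K : Type*} [Field K] [CharZero K] {s : ℕ} (A : LineArrangement K s)
    (hA : A.rank = 3) :
    ((A.mdr : ℤ) = (s : ℤ) - (A.maxMultiplicity : ℤ) ∨
      (A.mdr : ℤ) ≥ (A.minRestriction : ℤ) - 1) ∧
    (A.minRestriction : ℤ) - 1 ≤ (A.mdr : ℤ) ∧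
    (A.mdr : ℤ) ≤ (s : ℤ) - (A.maxMultiplicity : ℤ) := by
  have hs : 3 ≤ s := hA ▸ A.rank_le
  have hmem := A.sub_maxMultiplicity_mem_degrees (by omega)
  have hlower : A.minRestriction ≤ A.mdr + 1 :=
    A.minRestriction_le_degree_add_one (by omega) (Nat.sInf_mem ⟨_, hmem⟩)
  have hupper : A.mdr ≤ s - A.maxMultiplicity := Nat.sInf_le hmem
  -- Needed to read the truncated `s - A.maxMultiplicity` as a difference of integers.
  have hle : A.maxMultiplicity ≤ s := by
    obtain ⟨P, -, hm⟩ := A.maxMultiplicity_mem (by omega)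
    exact hm ▸ A.multiplicity_le P
  omega
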